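/- **Proposition 1.1.** Let $(M,g)$ be a (finite-dimensional, smooth) Riemannian manifold and let $X$ be a smooth vector field on $M$. Then $X$ is a Killing vector field, i.e. $L_Xg=0$, if and only if the following two assertions hold: 1. The divergence of $X$ with respect to the Levi-Civita connection $\nabla$ vanishes, i.e. $\operatorname{div}X=\operatorname{tr}(v\mapsto\nabla_vX)=0$ at every point of $M$. 2. For every open set $U\subset M$ and every function $f\in C^\infty(U)$ such that $X(f)=0$ on $U$, one has $[X,\nabla f]=0$ on $U$, where $\nabla f$ is the gradient field of $f$, defined by $g(\nabla f,Y)=df(Y)$ for every vector field $Y$ on $U$. -/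

import Mathlib

open Bundle Set Topology VectorField FiberBundle
open scoped Manifold ContDiff

noncomputable section

set_option linter.unusedSectionVars false

namespace RiemannianGeometry

variable {E : Type*} [NormedAddCommGroup E] [NormedSpace ℝ E] [FiniteDimensional ℝ E]
  {H : Type*} [TopologicalSpace H] (I : ModelWithCorners ℝ E H)
  {M : Type*} [TopologicalSpace M] [ChartedSpace H M] [IsManifold I ∞ M]
  [RiemannianBundle (fun x : M => TangentSpace I x)]
  [IsContMDiffRiemannianBundle I ∞ E (fun x : M => TangentSpace I x)]

theorem completeSpace_tangentSpace (x : M) : CompleteSpace (TangentSpace I x) :=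
  haveI : FiniteDimensional ℝ (TangentSpace I x) := inferInstanceAs (FiniteDimensional ℝ E)
  FiniteDimensional.complete ℝ (TangentSpace I x)

/-- The pointwise inner product `g(Y, Z)` of two vector fields, as a function on `M`. -/
def metric (Y Z : Π x : M, TangentSpace I x) : M → ℝ := fun x => inner ℝ (Y x) (Z x)

/-- The derivative `Y(f)` of a function `f` along the vector field `Y`. -/
def dirDeriv (Y : Π x : M, TangentSpace I x) (f : M → ℝ) : M → ℝ :=
  fun x => mvfderiv I f x (Y x)

/-- The right-hand side of the Koszul formula for `g(∇_Y X, Z)`. -/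
def koszul (X Y Z : Π x : M, TangentSpace I x) (x : M) : ℝ :=
  (1 / 2 : ℝ) * (dirDeriv I Y (metric I X Z) x + dirDeriv I X (metric I Y Z) x
    - dirDeriv I Z (metric I X Y) x + metric I (mlieBracket I Y X) Z x
    - metric I (mlieBracket I X Z) Y x - metric I (mlieBracket I Y Z) X x)

section koszul

variable {I} {X X' Y Y' Z Z' : Π x : M, TangentSpace I x} {x : M} {f : M → ℝ}

theorem metric_comm (Y Z : Π x : M, TangentSpace I x) : metric I Y Z = metric I Z Y :=
  funext fun _ => real_inner_comm _ _

theorem mdifferentiableAt_metric (hY : MDiffAt (T% Y) x) (hZ : MDiffAt (T% Z) x) :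
    MDifferentiableAt I 𝓘(ℝ, ℝ) (metric I Y Z) x :=
  MDifferentiableAt.inner_bundle hY hZ

theorem dirDeriv_metric_add_left (V : Π x : M, TangentSpace I x)
    (hY : MDiffAt (T% Y) x) (hY' : MDiffAt (T% Y') x) (hZ : MDiffAt (T% Z) x) :
    dirDeriv I V (metric I (Y + Y') Z) x
      = dirDeriv I V (metric I Y Z) x + dirDeriv I V (metric I Y' Z) x := by
  have h : metric I (Y + Y') Z = metric I Y Z + metric I Y' Z := by
    funext y
    simp [metric, inner_add_left]
  rw [h, dirDeriv, mvfderiv_add (mdifferentiableAt_metric hY hZ) (mdifferentiableAt_metric hY' hZ)]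
  rfl

theorem dirDeriv_metric_smul_left (V : Π x : M, TangentSpace I x)
    (hf : MDifferentiableAt I 𝓘(ℝ, ℝ) f x) (hY : MDiffAt (T% Y) x) (hZ : MDiffAt (T% Z) x) :
    dirDeriv I V (metric I (f • Y) Z) x
      = f x * dirDeriv I V (metric I Y Z) x + dirDeriv I V f x * metric I Y Z x := by
  have h : metric I (f • Y) Z = f * metric I Y Z := by
    funext y
    simp [metric, inner_smul_left]
  rw [h, dirDeriv, mvfderiv_mul hf (mdifferentiableAt_metric hY hZ)]
  simp [dirDeriv, mul_comm]

theorem dirDeriv_metric_add_right (V : Π x : M, TangentSpace I x)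
    (hY : MDiffAt (T% Y) x) (hY' : MDiffAt (T% Y') x) (hZ : MDiffAt (T% Z) x) :
    dirDeriv I V (metric I Z (Y + Y')) x
      = dirDeriv I V (metric I Z Y) x + dirDeriv I V (metric I Z Y') x := by
  simp only [metric_comm Z]
  exact dirDeriv_metric_add_left V hY hY' hZ

theorem dirDeriv_metric_smul_right (V : Π x : M, TangentSpace I x)
    (hf : MDifferentiableAt I 𝓘(ℝ, ℝ) f x) (hY : MDiffAt (T% Y) x) (hZ : MDiffAt (T% Z) x) :
    dirDeriv I V (metric I Z (f • Y)) x
      = f x * dirDeriv I V (metric I Z Y) x + dirDeriv I V f x * metric I Z Y x := by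
  simp only [metric_comm Z]
  exact dirDeriv_metric_smul_left V hf hY hZ

theorem dirDeriv_add (V V' : Π x : M, TangentSpace I x) (h : M → ℝ) :
    dirDeriv I (V + V') h x = dirDeriv I V h x + dirDeriv I V' h x :=
  map_add (mvfderiv I h x) _ _

theorem dirDeriv_smul (V : Π x : M, TangentSpace I x) (h : M → ℝ) :
    dirDeriv I (f • V) h x = f x * dirDeriv I V h x :=
  map_smul (mvfderiv I h x) _ _

theorem koszul_tensorial₁ (hX : MDiffAt (T% X) x) (hZ : MDiffAt (T% Z) x) :
    TensorialAt I E (fun Y => koszul I X Y Z x) x where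
  smul {f Y} hf hY := by
    have : CompleteSpace E := FiniteDimensional.complete ℝ E
    simp only [koszul, dirDeriv_smul, dirDeriv_metric_smul_left _ hf hY hZ,
      dirDeriv_metric_smul_right _ hf hY hX]
    simp [metric, dirDeriv, inner_add_left, inner_smul_left, inner_smul_right,
      mlieBracket_smul_left hf hY, real_inner_comm (Y x) (X x)]
    ring
  add {Y Y'} hY hY' := by
    have : CompleteSpace E := FiniteDimensional.complete ℝ E
    simp only [koszul, dirDeriv_add, dirDeriv_metric_add_left _ hY hY' hZ,
      dirDeriv_metric_add_right _ hY hY' hX, metric, mlieBracket_add_left hY hY',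
      inner_add_left, inner_add_right, Pi.add_apply]
    ring

theorem koszul_tensorial₂ (hX : MDiffAt (T% X) x) (hY : MDiffAt (T% Y) x) :
    TensorialAt I E (fun Z => koszul I X Y Z x) x where
  smul {f Z} hf hZ := by
    have : CompleteSpace E := FiniteDimensional.complete ℝ E
    simp only [koszul, dirDeriv_smul, dirDeriv_metric_smul_right _ hf hZ hX,
      dirDeriv_metric_smul_right _ hf hZ hY]
    simp [metric, dirDeriv, inner_add_left, inner_smul_left, inner_smul_right,
      mlieBracket_smul_right hf hZ, real_inner_comm (Z x)]
    ring
  add {Z Z'} hZ hZ' := by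
    have : CompleteSpace E := FiniteDimensional.complete ℝ E
    simp only [koszul, dirDeriv_add, dirDeriv_metric_add_right _ hZ hZ' hX,
      dirDeriv_metric_add_right _ hZ hZ' hY, metric, mlieBracket_add_right hZ hZ',
      inner_add_left, inner_add_right, Pi.add_apply]
    ring

theorem koszul_add (hX : MDiffAt (T% X) x) (hX' : MDiffAt (T% X') x) (hY : MDiffAt (T% Y) x)
    (hZ : MDiffAt (T% Z) x) :
    koszul I (X + X') Y Z x = koszul I X Y Z x + koszul I X' Y Z x := by
  have : CompleteSpace E := FiniteDimensional.complete ℝ E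
  simp only [koszul, dirDeriv_add, dirDeriv_metric_add_left _ hX hX' hZ,
    dirDeriv_metric_add_left _ hX hX' hY, metric, mlieBracket_add_right hX hX',
    mlieBracket_add_left hX hX', inner_add_left, inner_add_right, Pi.add_apply]
  ring

theorem koszul_smul (hf : MDifferentiableAt I 𝓘(ℝ, ℝ) f x) (hX : MDiffAt (T% X) x)
    (hY : MDiffAt (T% Y) x) (hZ : MDiffAt (T% Z) x) :
    koszul I (f • X) Y Z x = f x * koszul I X Y Z x + dirDeriv I Y f x * metric I X Z x := by
  have : CompleteSpace E := FiniteDimensional.complete ℝ E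
  simp only [koszul, dirDeriv_smul, dirDeriv_metric_smul_left _ hf hX hZ,
    dirDeriv_metric_smul_left _ hf hX hY]
  simp [metric, dirDeriv, inner_add_left, inner_smul_left, inner_smul_right,
    mlieBracket_smul_right hf hX, mlieBracket_smul_left hf hX]
  ring

end koszul

open Classical in
/-- The Koszul form of `X` at `x`: the bilinear form `(v, w) ↦ g(∇_v X, w)` on the tangent space
at `x`, obtained from the Koszul formula with arbitrary extensions of `v` and `w`. -/
def koszulForm (X : Π x : M, TangentSpace I x) (x : M) :
    TangentSpace I x →L[ℝ] TangentSpace I x →L[ℝ] ℝ :=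
  if hX : MDiffAt (T% X) x then
    TensorialAt.mkHom₂ (fun Y Z => koszul I X Y Z x) x
      (fun _ hZ => koszul_tensorial₁ hX hZ) (fun _ hY => koszul_tensorial₂ hX hY)
  else 0

theorem koszulForm_apply {X Y Z : Π x : M, TangentSpace I x} {x : M}
    (hX : MDiffAt (T% X) x) (hY : MDiffAt (T% Y) x) (hZ : MDiffAt (T% Z) x) :
    koszulForm I X x (Y x) (Z x) = koszul I X Y Z x := by
  rw [koszulForm, dif_pos hX]
  exact TensorialAt.mkHom₂_apply _ _ hY hZ

/-- The covariant derivative `v ↦ ∇_v X` of `X` at `x`: the vector `∇_v X` represents the linear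
form `w ↦ koszulForm X x v w` with respect to the metric. -/
def leviCivitaFun (X : Π x : M, TangentSpace I x) (x : M) :
    TangentSpace I x →L[ℝ] TangentSpace I x :=
  haveI := completeSpace_tangentSpace I x
  { toFun := fun v => (InnerProductSpace.toDual ℝ (TangentSpace I x)).symm (koszulForm I X x v)
    map_add' := fun v w => by simp
    map_smul' := fun c v => by simp
    cont := by fun_prop }

theorem inner_leviCivitaFun (X : Π x : M, TangentSpace I x) (x : M) (v w : TangentSpace I x) :
    inner ℝ (leviCivitaFun I X x v) w = koszulForm I X x v w := by
  have := completeSpace_tangentSpace I x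
  exact InnerProductSpace.toDual_symm_apply

theorem inner_leviCivitaFun_eq_koszul {X Y Z : Π x : M, TangentSpace I x} {x : M}
    (hX : MDiffAt (T% X) x) (hY : MDiffAt (T% Y) x) (hZ : MDiffAt (T% Z) x) :
    inner ℝ (leviCivitaFun I X x (Y x)) (Z x) = koszul I X Y Z x := by
  rw [inner_leviCivitaFun, koszulForm_apply I hX hY hZ]

theorem ext_inner_extend {x : M} {A B : TangentSpace I x →L[ℝ] TangentSpace I x}
    (h : ∀ Y Z : Π x : M, TangentSpace I x, MDiffAt (T% Y) x → MDiffAt (T% Z) x →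
      inner ℝ (A (Y x)) (Z x) = inner ℝ (B (Y x)) (Z x)) : A = B := by
  ext v
  refine ext_inner_right ℝ fun w => ?_
  simpa using h (extend E v) (extend E w) (mdifferentiableAt_extend I E v)
    (mdifferentiableAt_extend I E w)

/-- The Levi-Civita connection of the Riemannian manifold `M`; `leviCivita I X x v` is `∇_v X`. -/
def leviCivita : CovariantDerivative I E (fun x : M => TangentSpace I x) where
  toFun := leviCivitaFun I
  isCovariantDerivativeOnUniv :=
    { add := by
        intro X X' x hX hX' _
        refine ext_inner_extend I fun Y Z hY hZ => ?_
        rw [inner_leviCivitaFun_eq_koszul I (mdifferentiableAt_add_section hX hX') hY hZ,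
          koszul_add hX hX' hY hZ, add_apply, inner_add_left,
          inner_leviCivitaFun_eq_koszul I hX hY hZ, inner_leviCivitaFun_eq_koszul I hX' hY hZ]
      leibniz := by
        intro X f x hX hf _
        refine ext_inner_extend I fun Y Z hY hZ => ?_
        rw [inner_leviCivitaFun_eq_koszul I (hf.smul_section hX) hY hZ,
          koszul_smul hf hX hY hZ, add_apply, inner_add_left,
          smul_apply, inner_smul_left,
          inner_leviCivitaFun_eq_koszul I hX hY hZ]
        simp [dirDeriv, metric, inner_smul_left] }

/-- The Levi-Civita connection is torsion-free. -/
theorem leviCivita_torsion [CompleteSpace E] : (leviCivita I (M := M)).torsion = 0 := by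
  rw [CovariantDerivative.torsion_eq_zero_iff]
  intro X Y x hX hY
  refine ext_inner_right ℝ fun w => ?_
  have hw := mdifferentiableAt_extend I E w
  have h1 := inner_leviCivitaFun_eq_koszul I hY hX hw
  have h2 := inner_leviCivitaFun_eq_koszul I hX hY hw
  rw [extend_apply_self] at h1 h2
  change inner ℝ (leviCivitaFun I Y x (X x) - leviCivitaFun I X x (Y x)) w = _
  rw [inner_sub_left, h1, h2, koszul, koszul, mlieBracket_swap (V := Y) (W := X),
    metric_comm Y X]
  simp [metric, inner_neg_left]
  ring

/-- The Levi-Civita connection is compatible with the metric: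
`Y(g(X, Z)) = g(∇_Y X, Z) + g(X, ∇_Y Z)`. -/
theorem leviCivita_metric {X Y Z : Π x : M, TangentSpace I x} {x : M}
    (hX : MDiffAt (T% X) x) (hY : MDiffAt (T% Y) x) (hZ : MDiffAt (T% Z) x) :
    dirDeriv I Y (metric I X Z) x
      = inner ℝ (leviCivita I X x (Y x)) (Z x) + inner ℝ (X x) (leviCivita I Z x (Y x)) := by
  have h1 := inner_leviCivitaFun_eq_koszul I hX hY hZ
  have h2 := inner_leviCivitaFun_eq_koszul I hZ hY hX
  change dirDeriv I Y (metric I X Z) x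
    = inner ℝ (leviCivitaFun I X x (Y x)) (Z x) + inner ℝ (X x) (leviCivitaFun I Z x (Y x))
  rw [real_inner_comm _ (X x), h1, h2, koszul, koszul, mlieBracket_swap (V := Z) (W := X),
    metric_comm Z X, metric_comm Y X, metric_comm Z Y]
  simp [metric, inner_neg_left]
  ring

/-- The divergence of `X` with respect to the Levi-Civita connection: the trace of `v ↦ ∇_v X`. -/
def divergence (X : Π x : M, TangentSpace I x) (x : M) : ℝ :=
  LinearMap.trace ℝ (TangentSpace I x) (leviCivita I X x).toLinearMap

/-- The gradient of `f`: the vector field with `g(∇f, Y) = df(Y)`. -/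
def gradient (f : M → ℝ) (x : M) : TangentSpace I x :=
  haveI := completeSpace_tangentSpace I x
  (InnerProductSpace.toDual ℝ (TangentSpace I x)).symm (mvfderiv I f x)

theorem inner_gradient (f : M → ℝ) (x : M) (v : TangentSpace I x) :
    inner ℝ (gradient I f x) v = mvfderiv I f x v := by
  have := completeSpace_tangentSpace I x
  exact InnerProductSpace.toDual_symm_apply

/-- The Lie derivative of the metric along `X`, evaluated on the vector fields `Y` and `Z`:
`(L_X g)(Y, Z) = X(g(Y, Z)) - g([X, Y], Z) - g(Y, [X, Z])`. -/
def lieDerivMetric (X Y Z : Π x : M, TangentSpace I x) (x : M) : ℝ :=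
  dirDeriv I X (metric I Y Z) x - metric I (mlieBracket I X Y) Z x
    - metric I Y (mlieBracket I X Z) x

/-- `X` is a Killing vector field: `(L_X g)(Y, Z) = 0` for all smooth vector fields `Y`, `Z`
defined on an open subset of `M`. -/
def IsKilling (X : Π x : M, TangentSpace I x) : Prop :=
  ∀ U : Set M, IsOpen U → ∀ Y Z : Π x : M, TangentSpace I x,
    ContMDiffOn I I.tangent ∞ (fun x => (⟨x, Y x⟩ : TangentBundle I M)) U →
    ContMDiffOn I I.tangent ∞ (fun x => (⟨x, Z x⟩ : TangentBundle I M)) U →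
    ∀ x ∈ U, lieDerivMetric I X Y Z x = 0

end RiemannianGeometry

end

noncomputable section

set_option linter.unusedSectionVars false

namespace RiemannianGeometry

universe u

section Nemytskii

variable {K : Type*} [TopologicalSpace K] [CompactSpace K]
  {V E F : Type*} [NormedAddCommGroup V] [NormedSpace ℝ V]
  [NormedAddCommGroup E] [NormedSpace ℝ E] [NormedAddCommGroup F] [NormedSpace ℝ F]

theorem norm_bilinear_apply_continuousMap_le (B : V →L[ℝ] E →L[ℝ] F) (A : C(K, V)) (h : C(K, E))
    (t : K) : ‖B (A t) (h t)‖ ≤ ‖B‖ * ‖A‖ * ‖h‖ :=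
  (B.le_opNorm₂ _ _).trans (by gcongr <;> exact ContinuousMap.norm_coe_le_norm _ t)

/-- The pointwise extension of a continuous bilinear map to spaces of continuous functions on a
compact space. -/
def pointwiseBilinear (B : V →L[ℝ] E →L[ℝ] F) : C(K, V) →L[ℝ] C(K, E) →L[ℝ] C(K, F) :=
  LinearMap.mkContinuous₂
    (LinearMap.mk₂ ℝ (fun (A : C(K, V)) (h : C(K, E)) =>
        (⟨fun t => B (A t) (h t), (B.continuous.comp A.continuous).clm_apply h.continuous⟩ :
          C(K, F)))
      (fun _ _ _ => by ext; simp) (fun _ _ _ => by ext; simp)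
      (fun _ _ _ => by ext; simp) (fun _ _ _ => by ext; simp)) ‖B‖
    (fun A h => by
      rw [ContinuousMap.norm_le _ (by positivity)]
      exact norm_bilinear_apply_continuousMap_le B A h)

theorem contDiff_pointwiseBilinear_comp {W : Type*} [NormedAddCommGroup W] [NormedSpace ℝ W]
    (B : V →L[ℝ] E →L[ℝ] F) {n : ℕ∞ω} {g : W → C(K, V)} (hg : ContDiff ℝ n g) :
    ContDiff ℝ n fun w => pointwiseBilinear (F := F) B (g w) :=
  have h : ContDiff ℝ n fun A : C(K, V) => pointwiseBilinear (F := F) B A :=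
    (pointwiseBilinear (K := K) B).contDiff
  h.comp hg

/-- If `G` has derivative `B (G' x)` at each `x`, with `G'` continuous, then the composition
operator `γ ↦ G ∘ γ` has derivative `h ↦ B (G' ∘ γ) h`. -/
theorem hasFDerivAt_continuousMap_comp (B : V →L[ℝ] E →L[ℝ] F) {G : C(E, F)} {G' : C(E, V)}
    (hG : ∀ x, HasFDerivAt G (B (G' x)) x) (γ : C(K, E)) :
    HasFDerivAt (fun γ : C(K, E) => G.comp γ) (pointwiseBilinear B (G'.comp γ)) γ := by
  rw [hasFDerivAt_iff_isLittleO_nhds_zero, Asymptotics.isLittleO_iff]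
  intro ε hε
  have hcont : Continuous fun γ : C(K, E) => G'.comp γ := G'.continuous_postcomp
  obtain ⟨δ, hδ, hball⟩ :=
    Metric.continuousAt_iff.1 (hcont.continuousAt (x := γ)) (ε / (‖B‖ + 1)) (by positivity)
  filter_upwards [Metric.ball_mem_nhds (0 : C(K, E)) hδ] with h hh
  rw [mem_ball_zero_iff] at hh
  rw [ContinuousMap.norm_le _ (by positivity)]
  intro t
  have key := (convex_ball (γ t) δ).norm_image_sub_le_of_norm_hasFDerivWithin_le'
    (f := G) (f' := fun x => B (G' x)) (φ := B (G' (γ t))) (C := ε) (x := γ t) (y := γ t + h t)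
    (fun x _ => (hG x).hasFDerivWithinAt) ?_ (Metric.mem_ball_self hδ) ?_
  · rw [add_sub_cancel_left] at key
    exact key.trans (mul_le_mul_of_nonneg_left (ContinuousMap.norm_coe_le_norm h t) hε.le)
  · intro x hx
    have hx' : dist (γ + ContinuousMap.const K (x - γ t)) γ < δ := by
      rw [dist_eq_norm, add_sub_cancel_left]
      refine lt_of_le_of_lt ?_ (mem_ball_iff_norm.1 hx)
      rw [ContinuousMap.norm_le _ (norm_nonneg _)]
      exact fun _ => le_rfl
    have h2 := (ContinuousMap.dist_apply_le_dist t).trans (hball hx').le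
    have h3 : ‖G' x - G' (γ t)‖ ≤ ε / (‖B‖ + 1) := by simpa [dist_eq_norm] using h2
    rw [← map_sub]
    calc ‖B (G' x - G' (γ t))‖ ≤ ‖B‖ * (ε / (‖B‖ + 1)) := B.le_opNorm_of_le h3
      _ ≤ (‖B‖ + 1) * (ε / (‖B‖ + 1)) := by gcongr; linarith
      _ = ε := by field_simp
  · rw [mem_ball_iff_norm, add_sub_cancel_left]
    exact (ContinuousMap.norm_coe_le_norm h t).trans_lt hh

end Nemytskii

theorem contDiff_continuousMap_comp_nat {K : Type*} [TopologicalSpace K] [CompactSpace K]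
    {E : Type u} [NormedAddCommGroup E] [NormedSpace ℝ E] (n : ℕ) :
    ∀ {F : Type u} [NormedAddCommGroup F] [NormedSpace ℝ F] (G : C(E, F)), ContDiff ℝ n G →
      ContDiff ℝ n (fun γ : C(K, E) => G.comp γ) := by
  induction n with
  | zero =>
    intro F _ _ G _
    exact contDiff_zero.2 G.continuous_postcomp
  | succ n ih =>
    intro F _ _ G hG
    obtain ⟨G', hG', hder⟩ := contDiff_succ_iff_hasFDerivAt.1 (by exact_mod_cast hG)
    refine contDiff_succ_iff_hasFDerivAt.2 ⟨_, ?_, hasFDerivAt_continuousMap_comp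
      (ContinuousLinearMap.id ℝ (E →L[ℝ] F)) (G' := ⟨G', hG'.continuous⟩) hder⟩
    exact contDiff_pointwiseBilinear_comp _ (ih ⟨G', hG'.continuous⟩ hG')

theorem contDiff_continuousMap_comp {K : Type*} [TopologicalSpace K] [CompactSpace K]
    {E : Type*} [NormedAddCommGroup E] [NormedSpace ℝ E] {G : C(E, E)} (hG : ContDiff ℝ ∞ G) :
    ContDiff ℝ ∞ (fun γ : C(K, E) => G.comp γ) :=
  contDiff_infty.2 fun n => contDiff_continuousMap_comp_nat n G (contDiff_infty.1 hG n)

/-- Inverse function theorem for `C^∞` functions: near a point with invertible derivative, the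
function restricts to a partial homeomorphism with smooth inverse on its whole target, and with
invertible derivative on its whole source. -/
theorem exists_openPartialHomeomorph_contDiffOn_symm
    {E F : Type*} [NormedAddCommGroup E] [NormedSpace ℝ E] [CompleteSpace E]
    [NormedAddCommGroup F] [NormedSpace ℝ F] {f : E → F} {a : E} {f' : E ≃L[ℝ] F} {s : Set E}
    (hs : IsOpen s) (ha : a ∈ s) (hf : ContDiffOn ℝ ∞ f s)
    (hf' : HasFDerivAt f (f' : E →L[ℝ] F) a) :
    ∃ e : OpenPartialHomeomorph E F, a ∈ e.source ∧ e.source ⊆ s ∧ (∀ x, e x = f x) ∧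
      ContDiffOn ℝ ∞ e.symm e.target ∧
      ∀ x ∈ e.source, ∃ A : E ≃L[ℝ] F, HasFDerivAt f (A : E →L[ℝ] F) x := by
  have hfa : ContDiffAt ℝ ∞ f a := hf.contDiffAt (hs.mem_nhds ha)
  let e₀ := hfa.toOpenPartialHomeomorph f hf' (by simp)
  have hcont : ContinuousOn (fderiv ℝ f) s :=
    hf.continuousOn_fderiv_of_isOpen hs (by simp)
  let t : Set E := s ∩ fderiv ℝ f ⁻¹' range ((↑) : (E ≃L[ℝ] F) → E →L[ℝ] F)
  have ht : IsOpen t := hcont.isOpen_inter_preimage hs ContinuousLinearEquiv.isOpen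
  have hat : a ∈ t := ⟨ha, f', hf'.fderiv.symm⟩
  have hder : ∀ x ∈ t, ∃ A : E ≃L[ℝ] F, HasFDerivAt f (A : E →L[ℝ] F) x := by
    rintro x ⟨hxs, A, hA⟩
    refine ⟨A, ?_⟩
    rw [hA]
    exact ((hf.contDiffAt (hs.mem_nhds hxs)).differentiableAt (by simp)).hasFDerivAt
  have hsrc : (e₀.restrOpen t ht).source ⊆ t := inter_subset_right
  refine ⟨e₀.restrOpen t ht, ⟨hfa.mem_toOpenPartialHomeomorph_source hf' (by simp), hat⟩,
    hsrc.trans inter_subset_left, fun x => rfl, ?_, fun x hx => hder x (hsrc hx)⟩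
  intro y hy
  have hx := hsrc ((e₀.restrOpen t ht).map_target hy)
  obtain ⟨A, hA⟩ := hder _ hx
  exact ((e₀.restrOpen t ht).contDiffAt_symm hy hA
    (hf.contDiffAt (hs.mem_nhds hx.1))).contDiffWithinAt

section Flow

variable {E : Type*} [NormedAddCommGroup E] [NormedSpace ℝ E]

/-- The derivative of the composition operator `γ ↦ X ∘ γ` on continuous paths, where `X'` is the
derivative of `X`. -/
def compDeriv (X' : C(E, E →L[ℝ] E)) (γ : C(unitInterval, E)) :
    C(unitInterval, E) →L[ℝ] C(unitInterval, E) :=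
  pointwiseBilinear (ContinuousLinearMap.id ℝ (E →L[ℝ] E)) (X'.comp γ)

@[simp]
theorem compDeriv_apply (X' : C(E, E →L[ℝ] E)) (γ h : C(unitInterval, E)) (t : unitInterval) :
    compDeriv X' γ h t = X' (γ t) (h t) := rfl

/-- Constant paths, as a continuous linear map. -/
def constPath : E →L[ℝ] C(unitInterval, E) :=
  LinearMap.mkContinuous
    { toFun := fun x => ContinuousMap.const unitInterval x
      map_add' := fun _ _ => rfl
      map_smul' := fun _ _ => rfl } 1
    (fun x => by
      rw [one_mul, ContinuousMap.norm_le _ (norm_nonneg _)]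
      exact fun _ => le_rfl)

@[simp]
theorem constPath_apply (x : E) (t : unitInterval) : constPath x t = x := rfl

theorem continuous_comp_projIcc (γ : C(unitInterval, E)) :
    Continuous fun τ : ℝ => γ (projIcc 0 1 zero_le_one τ) :=
  γ.continuous.comp continuous_projIcc

/-- The primitive vanishing at `0` of a continuous path, as a continuous linear map. -/
def integralPath : C(unitInterval, E) →L[ℝ] C(unitInterval, E) :=
  LinearMap.mkContinuous
    { toFun := fun γ => ⟨fun t => ∫ τ in (0 : ℝ)..t, γ (projIcc 0 1 zero_le_one τ),
        (intervalIntegral.continuous_primitive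
          (fun _ _ => (continuous_comp_projIcc γ).intervalIntegrable _ _) 0).comp
          continuous_subtype_val⟩
      map_add' := fun γ γ' => by
        ext t
        exact intervalIntegral.integral_add
          ((continuous_comp_projIcc γ).intervalIntegrable _ _)
          ((continuous_comp_projIcc γ').intervalIntegrable _ _)
      map_smul' := fun c γ => by
        ext t
        exact intervalIntegral.integral_smul _ _ } 1
    (fun γ => by
      rw [one_mul, ContinuousMap.norm_le _ (norm_nonneg _)]
      intro t
      refine (intervalIntegral.norm_integral_le_of_norm_le_const
        (fun τ _ => γ.norm_coe_le_norm _)).trans ?_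
      rw [sub_zero, abs_of_nonneg t.2.1]
      exact mul_le_of_le_one_right (norm_nonneg _) t.2.2)

theorem integralPath_apply (γ : C(unitInterval, E)) (t : unitInterval) :
    integralPath γ t = ∫ τ in (0 : ℝ)..t, γ (projIcc 0 1 zero_le_one τ) := rfl

variable [CompleteSpace E]

/-- If `γ` solves the integral equation of the flow of `s X`, then `t ↦ t X(γ(t))` solves the
equation obtained by differentiating it in `s`. -/
theorem id_smul_comp_eq_integralPath {X : C(E, E)} {X' : C(E, E →L[ℝ] E)}
    (hX : ∀ x, HasFDerivAt X (X' x) x) {x : E} {s : ℝ} {γ ζ : C(unitInterval, E)}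
    (hγ : γ = constPath x + s • integralPath (X.comp γ)) (hζ : ∀ t, ζ t = (t : ℝ) • X (γ t)) :
    ζ = integralPath (X.comp γ) + s • integralPath (compDeriv X' γ ζ) := by
  let β : ℝ → E := fun τ => X (γ (projIcc 0 1 zero_le_one τ))
  have hβ : Continuous β := continuous_comp_projIcc (X.comp γ)
  let c : ℝ → E := fun τ => x + s • ∫ u in (0 : ℝ)..τ, β u
  have hc : ∀ τ, HasDerivAt c (s • β τ) τ := fun τ =>
    ((intervalIntegral.integral_hasDerivAt_right (hβ.intervalIntegrable _ _)
      hβ.aestronglyMeasurable.stronglyMeasurableAtFilter hβ.continuousAt).const_smul s).const_add x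
  have hcγ : ∀ t : unitInterval, γ t = c t := fun t => by
    conv_lhs => rw [hγ]
    rfl
  have hcc : Continuous c := continuous_iff_continuousAt.2 fun τ => (hc τ).continuousAt
  have hd : ∀ τ, HasDerivAt (fun τ => τ • X (c τ))
      (τ • X' (c τ) (s • β τ) + (1 : ℝ) • X (c τ)) τ := fun τ =>
    (hasDerivAt_id τ).smul ((hX (c τ)).comp_hasDerivAt τ (hc τ))
  have hint : Continuous fun τ => τ • X' (c τ) (s • β τ) + (1 : ℝ) • X (c τ) := by
    fun_prop
  ext t
  have h1 := intervalIntegral.integral_eq_sub_of_hasDerivAt (a := 0) (b := (t : ℝ))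
    (fun τ _ => hd τ) (hint.intervalIntegrable _ _)
  rw [zero_smul, sub_zero, ← hcγ t, ← hζ t] at h1
  rw [← h1, ← map_smul, ← map_add, integralPath_apply]
  refine intervalIntegral.integral_congr fun τ hτ => ?_
  rw [uIcc_of_le t.2.1] at hτ
  have hproj : projIcc 0 1 zero_le_one τ = (⟨τ, hτ.1, hτ.2.trans t.2.2⟩ : unitInterval) :=
    projIcc_of_mem _ _
  simp only [β, hproj, one_smul, ContinuousMap.add_apply, ContinuousMap.smul_apply,
    compDeriv_apply, ContinuousMap.comp_apply, hζ, ← hcγ ⟨τ, hτ.1, hτ.2.trans t.2.2⟩]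
  rw [map_smul, map_smul, smul_comm, add_comm]

/-- The map whose zeros in `γ` are the solutions of the integral equation of the flow. -/
def flowDefect (X : C(E, E)) (z : (E × ℝ) × C(unitInterval, E)) : C(unitInterval, E) :=
  z.2 - constPath z.1.1 - z.1.2 • integralPath (X.comp z.2)

/-- The derivative of `flowDefect`. -/
def flowDefectDeriv (X : C(E, E)) (X' : C(E, E →L[ℝ] E)) (z : (E × ℝ) × C(unitInterval, E)) :
    (E × ℝ) × C(unitInterval, E) →L[ℝ] C(unitInterval, E) :=
  .snd ℝ _ _ - constPath ∘L .fst ℝ _ _ ∘L .fst ℝ _ _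
    - (z.1.2 • (integralPath ∘L compDeriv X' z.2 ∘L .snd ℝ _ _)
      + (ContinuousLinearMap.snd ℝ _ _ ∘L .fst ℝ _ _).smulRight (integralPath (X.comp z.2)))

theorem flowDefectDeriv_apply (X : C(E, E)) (X' : C(E, E →L[ℝ] E))
    (z w : (E × ℝ) × C(unitInterval, E)) :
    flowDefectDeriv X X' z w = w.2 - constPath w.1.1
      - (z.1.2 • integralPath (compDeriv X' z.2 w.2)
        + w.1.2 • integralPath (X.comp z.2)) := rfl

theorem hasFDerivAt_flowDefect {X : C(E, E)} {X' : C(E, E →L[ℝ] E)}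
    (hX : ∀ x, HasFDerivAt X (X' x) x) (z : (E × ℝ) × C(unitInterval, E)) :
    HasFDerivAt (flowDefect X) (flowDefectDeriv X X' z) z := by
  have h1 : HasFDerivAt (fun γ : C(unitInterval, E) => X.comp γ) (compDeriv X' z.2) z.2 :=
    hasFDerivAt_continuousMap_comp (ContinuousLinearMap.id ℝ (E →L[ℝ] E)) hX z.2
  have h2 : HasFDerivAt (fun w : (E × ℝ) × C(unitInterval, E) => integralPath (X.comp w.2))
      (integralPath ∘L compDeriv X' z.2 ∘L .snd ℝ _ _) z :=
    (integralPath (E := E)).hasFDerivAt.comp z (h1.comp z hasFDerivAt_snd)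
  have h3 : HasFDerivAt (fun w : (E × ℝ) × C(unitInterval, E) => w.1.2)
      (ContinuousLinearMap.snd ℝ _ _ ∘L .fst ℝ _ _) z :=
    hasFDerivAt_snd.comp z hasFDerivAt_fst
  have h4 : HasFDerivAt (fun w : (E × ℝ) × C(unitInterval, E) => constPath w.1.1)
      (constPath ∘L .fst ℝ _ _ ∘L .fst ℝ _ _) z :=
    (constPath (E := E)).hasFDerivAt.comp z
      (HasFDerivAt.comp (g := Prod.fst) z hasFDerivAt_fst hasFDerivAt_fst)
  exact (hasFDerivAt_snd.sub h4).sub (h3.smul h2)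

theorem contDiff_flowDefect {X : C(E, E)} (hX : ContDiff ℝ ∞ X) :
    ContDiff ℝ ∞ (flowDefect X) := by
  have h1 : ContDiff ℝ ∞ fun w : (E × ℝ) × C(unitInterval, E) => integralPath (X.comp w.2) :=
    (integralPath (E := E)).contDiff.comp ((contDiff_continuousMap_comp hX).comp contDiff_snd)
  have h2 : ContDiff ℝ ∞ fun w : (E × ℝ) × C(unitInterval, E) => constPath w.1.1 :=
    (constPath (E := E)).contDiff.comp (contDiff_fst.comp contDiff_fst)
  exact (contDiff_snd.sub h2).sub ((contDiff_snd.comp contDiff_fst).smul h1)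

/-- A smooth vector field has a smooth local flow. -/
theorem exists_contDiffOn_localFlow {X : E → E} (hX : ContDiff ℝ ∞ X) (p : E) :
    ∃ (W : Set (E × ℝ)) (φ : E × ℝ → E), IsOpen W ∧ (p, 0) ∈ W ∧ ContDiffOn ℝ ∞ φ W ∧
      (∀ x, (x, (0 : ℝ)) ∈ W → φ (x, 0) = x) ∧
      ∀ x s, (x, s) ∈ W → HasDerivAt (fun s => φ (x, s)) (X (φ (x, s))) s := by
  let Y : C(E, E) := ⟨X, hX.continuous⟩
  let Y' : C(E, E →L[ℝ] E) := ⟨fderiv ℝ X, hX.continuous_fderiv (by simp)⟩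
  have hY : ∀ x, HasFDerivAt Y (Y' x) x := fun x =>
    (hX.differentiable (by simp) x).hasFDerivAt
  let Φ : (E × ℝ) × C(unitInterval, E) → (E × ℝ) × C(unitInterval, E) :=
    fun z => (z.1, flowDefect Y z)
  have hΦ : ContDiff ℝ ∞ Φ := contDiff_fst.prodMk (contDiff_flowDefect (X := Y) hX)
  have hΦ' : ∀ z, HasFDerivAt Φ ((ContinuousLinearMap.fst ℝ _ _).prod (flowDefectDeriv Y Y' z)) z :=
    fun z => hasFDerivAt_fst.prodMk (hasFDerivAt_flowDefect hY z)
  let a : (E × ℝ) × C(unitInterval, E) := ((p, 0), constPath p)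
  let A : ((E × ℝ) × C(unitInterval, E)) ≃L[ℝ] (E × ℝ) × C(unitInterval, E) :=
    (ContinuousLinearEquiv.refl ℝ (E × ℝ)).skewProd (.refl ℝ _)
      (flowDefectDeriv Y Y' a ∘L .inl ℝ _ _)
  have hA : HasFDerivAt Φ (A : _ →L[ℝ] _) a := by
    convert hΦ' a using 1
    refine ContinuousLinearMap.ext fun w => Prod.ext rfl ?_
    change w.2 + flowDefectDeriv Y Y' a (w.1, 0) = flowDefectDeriv Y Y' a w
    rw [flowDefectDeriv_apply, flowDefectDeriv_apply]
    simp only [a, zero_smul, zero_sub, zero_add]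
    abel
  obtain ⟨e, hae, -, he, hsymm, hder⟩ := exists_openPartialHomeomorph_contDiffOn_symm
    isOpen_univ (mem_univ a) hΦ.contDiffOn hA
  have hj : Continuous fun q : E × ℝ => (q, (0 : C(unitInterval, E))) := by fun_prop
  let W : Set (E × ℝ) := {q | (q, (0 : C(unitInterval, E))) ∈ e.target}
  have hW : IsOpen W := e.open_target.preimage hj
  let Γ : E × ℝ → C(unitInterval, E) := fun q => (e.symm (q, 0)).2
  have hΓ : ContDiffOn ℝ ∞ Γ W :=
    contDiff_snd.comp_contDiffOn (hsymm.comp (by fun_prop) fun q hq => hq)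
  have hsol : ∀ q ∈ W, e.symm (q, 0) = (q, Γ q) ∧ flowDefect Y (q, Γ q) = 0 := by
    intro q hq
    have h := e.right_inv hq
    rw [he] at h
    have h1 : (e.symm (q, 0)).1 = q := congrArg Prod.fst h
    have h2 : e.symm (q, 0) = (q, Γ q) := Prod.ext h1 rfl
    exact ⟨h2, h2 ▸ congrArg Prod.snd h⟩
  have heq : ∀ q ∈ W, Γ q = constPath q.1 + q.2 • integralPath (Y.comp (Γ q)) := fun q hq => by
    have h := (hsol q hq).2
    rw [flowDefect, sub_sub, sub_eq_zero] at h
    exact h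
  let ev : C(unitInterval, E) →L[ℝ] E := ContinuousMap.evalCLM ℝ 1
  refine ⟨W, fun q => ev (Γ q), hW, ?_, ev.contDiff.comp_contDiffOn hΓ, ?_, ?_⟩
  · have h := e.map_source hae
    rw [he] at h
    have h0 : Φ a = ((p, 0), 0) := by simp [Φ, a, flowDefect]
    rwa [h0] at h
  · intro x hx
    have h := heq _ hx
    rw [zero_smul, add_zero] at h
    simp [ev, h]
  · intro x s hxs
    have hΓd : HasFDerivAt Γ (fderiv ℝ Γ (x, s)) (x, s) :=
      ((hΓ.contDiffAt (hW.mem_nhds hxs)).differentiableAt (by simp)).hasFDerivAt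
    have hline : HasDerivAt (fun s : ℝ => (x, s)) ((0 : E), (1 : ℝ)) s :=
      (hasDerivAt_const s x).prodMk (hasDerivAt_id s)
    set η := fderiv ℝ Γ (x, s) (0, 1) with hη
    have hΓs : HasDerivAt (fun s => Γ (x, s)) η s := hΓd.comp_hasDerivAt s hline
    let ζ : C(unitInterval, E) :=
      ⟨fun t => (t : ℝ) • X (Γ (x, s) t), by
        have := hX.continuous
        fun_prop⟩
    have hζ := id_smul_comp_eq_integralPath hY (heq _ hxs) (ζ := ζ) fun t => rfl
    have hηeq : flowDefectDeriv Y Y' ((x, s), Γ (x, s)) ((0, 1), η) = 0 := by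
      have h1 := (hasFDerivAt_flowDefect hY ((x, s), Γ (x, s))).comp_hasDerivAt s
        (hline.prodMk hΓs)
      refine h1.unique ((hasDerivAt_const s (0 : C(unitInterval, E))).congr_of_eventuallyEq ?_)
      filter_upwards [hline.continuousAt.preimage_mem_nhds (hW.mem_nhds hxs)] with r hr
      exact (hsol _ hr).2
    rw [flowDefectDeriv_apply] at hηeq
    have hδ : flowDefectDeriv Y Y' ((x, s), Γ (x, s)) (0, η - ζ) = 0 := by
      rw [flowDefectDeriv_apply]
      simp only [map_zero, sub_zero, one_smul, Prod.fst_zero, Prod.snd_zero, zero_smul,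
        add_zero, map_sub, smul_sub] at hηeq ⊢
      rw [sub_eq_zero] at hηeq ⊢
      generalize integralPath (compDeriv Y' (Γ (x, s)) η) = u at hηeq ⊢
      generalize integralPath (compDeriv Y' (Γ (x, s)) ζ) = v at hζ ⊢
      rw [hηeq, hζ]
      abel
    obtain ⟨B, hB⟩ := hder _ (e.map_target hxs)
    have hB' : B (0, η - ζ) = 0 := by
      have h := hB.unique (hΦ' _)
      rw [(hsol _ hxs).1] at h
      have h2 := congrArg (fun T => T (0, η - ζ)) h
      simp only [ContinuousLinearEquiv.coe_coe] at h2
      rw [h2]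
      exact Prod.ext rfl hδ
    have h0 : η - ζ = 0 := congrArg Prod.snd ((map_eq_zero_iff B B.injective).1 hB')
    have h1 := ev.hasFDerivAt.comp_hasDerivAt s hΓs
    rw [sub_eq_zero.1 h0] at h1
    have h2 : ev ζ = X (Γ (x, s) 1) := one_smul ℝ _
    rw [h2] at h1
    exact h1

end Flow

section FirstIntegral

variable {E : Type*} [NormedAddCommGroup E] [NormedSpace ℝ E]

theorem exists_contDiff_eventuallyEq [FiniteDimensional ℝ E] {X : E → E} {s : Set E}
    (hs : IsOpen s) {p : E} (hp : p ∈ s) (hX : ContDiffOn ℝ ∞ X s) :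
    ∃ Y : E → E, ContDiff ℝ ∞ Y ∧ Y =ᶠ[𝓝 p] X := by
  obtain ⟨r, hr, hrs⟩ := Metric.isOpen_iff.1 hs p hp
  let χ : ContDiffBump p := ⟨r / 4, r / 2, by positivity, by linarith⟩
  refine ⟨fun x => χ x • X x, ?_, ?_⟩
  · refine contDiff_iff_contDiffAt.2 fun x => ?_
    by_cases hx : x ∈ tsupport fun x => χ x • X x
    swap
    · exact (contDiffAt_const (c := (0 : E))).congr_of_eventuallyEq
        (notMem_tsupport_iff_eventuallyEq.1 hx)
    have hx' : x ∈ tsupport χ := tsupport_smul_subset_left _ _ hx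
    rw [χ.tsupport_eq] at hx'
    have hxs : x ∈ s := hrs (Metric.closedBall_subset_ball (by simp [χ]; linarith) hx')
    exact χ.contDiffAt.smul (hX.contDiffAt (hs.mem_nhds hxs))
  · filter_upwards [χ.eventuallyEq_one] with x hx
    simp [hx]

/-- The local flow box: near a point where it does not vanish, a smooth vector field is the image
of a constant vector under a local diffeomorphism. -/
theorem exists_flowBox [CompleteSpace E] {X : E → E} (hX : ContDiff ℝ ∞ X) {p : E}
    (hp : X p ≠ 0) {V : Set E} (hV : V ∈ 𝓝 p) :
    ∃ e : OpenPartialHomeomorph E E, (0 : E) ∈ e.source ∧ e 0 = p ∧ e.target ⊆ V ∧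
      ContDiffOn ℝ ∞ e.symm e.target ∧ HasFDerivAt e (ContinuousLinearMap.id ℝ E) 0 ∧
      ∀ y ∈ e.source, HasDerivAt (fun τ : ℝ => e (y + τ • X p)) (X (e y)) 0 := by
  obtain ⟨W, φ, hW, hpW, hφ, hφ0, hφs⟩ := exists_contDiffOn_localFlow hX p
  obtain ⟨ℓ, hℓ⟩ := SeparatingDual.exists_eq_one (R := ℝ) hp
  let c : E → E × ℝ := fun y => (p + (y - ℓ y • X p), ℓ y)
  have hc : ContDiff ℝ ∞ c := by fun_prop
  let c' : E →L[ℝ] E × ℝ := (ContinuousLinearMap.id ℝ E - ℓ.smulRight (X p)).prod ℓ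
  have hc' : ∀ y, HasFDerivAt c c' y := fun y =>
    (((hasFDerivAt_id y).sub (ℓ.smulRight (X p)).hasFDerivAt).const_add p).prodMk ℓ.hasFDerivAt
  have hc0 : c 0 = (p, 0) := by simp [c]
  let Ψ : E → E := fun y => φ (c y)
  have hΨ0 : Ψ 0 = p := by simp only [Ψ, hc0, hφ0 p hpW]
  have hΨ : ContDiffOn ℝ ∞ Ψ (c ⁻¹' W) := hφ.comp hc.contDiffOn fun y hy => hy
  have hcW : IsOpen (c ⁻¹' W) := hW.preimage hc.continuous
  have hΨder : HasFDerivAt Ψ ((ContinuousLinearEquiv.refl ℝ E : E ≃L[ℝ] E) : E →L[ℝ] E) 0 := by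
    have hφd : HasFDerivAt φ (fderiv ℝ φ (p, 0)) (p, 0) :=
      ((hφ.contDiffAt (hW.mem_nhds hpW)).differentiableAt (by simp)).hasFDerivAt
    have h1 : ∀ v, fderiv ℝ φ (p, 0) (v, 0) = v := by
      intro v
      have hin : HasFDerivAt (fun x : E => (x, (0 : ℝ))) (ContinuousLinearMap.inl ℝ E ℝ) p :=
        hasFDerivAt_prodMk_left p 0
      have h2 : HasFDerivAt (fun x : E => φ (x, 0))
          (fderiv ℝ φ (p, 0) ∘L ContinuousLinearMap.inl ℝ E ℝ) p :=
        HasFDerivAt.comp (g := φ) p hφd hin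
      have h3 : (fun x : E => φ (x, 0)) =ᶠ[𝓝 p] id := by
        filter_upwards [hin.continuousAt.preimage_mem_nhds (hW.mem_nhds hpW)] with x hx
        exact hφ0 x hx
      exact congrArg (fun T => T v) (h2.unique ((hasFDerivAt_id p).congr_of_eventuallyEq h3))
    have h2 : fderiv ℝ φ (p, 0) (0, 1) = X p := by
      have hin : HasDerivAt (fun τ : ℝ => (p, τ)) ((0 : E), (1 : ℝ)) 0 :=
        (hasDerivAt_const _ p).prodMk (hasDerivAt_id _)
      have h3 := hφd.comp_hasDerivAt (0 : ℝ) hin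
      have h4 := hφs p 0 hpW
      rw [hφ0 p hpW] at h4
      exact h3.unique h4
    have h3 := HasFDerivAt.comp (g := φ) (f := c) 0 (by rw [hc0]; exact hφd) (hc' 0)
    have h4 : fderiv ℝ φ (p, 0) ∘L c' = ContinuousLinearMap.id ℝ E := by
      ext v
      have hsplit : c' v = (v - ℓ v • X p, 0) + ℓ v • ((0 : E), (1 : ℝ)) := by simp [c']
      rw [ContinuousLinearMap.comp_apply, hsplit, map_add, map_smul, h1, h2]
      simp
    rw [h4] at h3
    exact h3
  have hN : IsOpen (c ⁻¹' W ∩ Ψ ⁻¹' interior V) :=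
    hΨ.continuousOn.isOpen_inter_preimage hcW isOpen_interior
  obtain ⟨e, h0e, hesrc, heΨ, hesymm, -⟩ := exists_openPartialHomeomorph_contDiffOn_symm hN
    (a := 0) ⟨by simpa [hc0] using hpW, by
      rw [mem_preimage, hΨ0]
      exact mem_interior_iff_mem_nhds.2 hV⟩
    (hΨ.mono inter_subset_left) hΨder
  have heq : (e : E → E) = Ψ := funext heΨ
  refine ⟨e, h0e, by rw [heΨ, hΨ0], ?_, hesymm, by rw [heq]; exact hΨder, ?_⟩
  · intro u hu
    have h := (hesrc (e.map_target hu)).2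
    rw [mem_preimage, ← heΨ, e.right_inv hu] at h
    exact interior_subset h
  · intro y hy
    have hyW : c y ∈ W := (hesrc hy).1
    have h1 := HasDerivAt.comp_const_add (f := fun s => φ ((c y).1, s)) (ℓ y) 0
      (by rw [add_zero]; exact hφs _ _ hyW)
    have h2 : (fun τ : ℝ => e (y + τ • X p)) = fun τ => φ ((c y).1, ℓ y + τ) := by
      funext τ
      rw [heΨ]
      simp only [Ψ, c, map_add, map_smul, hℓ, smul_eq_mul, mul_one, add_smul]
      congr 2
      abel
    rw [h2, heΨ]
    exact h1

/-- Near a point where it does not vanish, a smooth vector field has first integrals with arbitrary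
differential among the linear forms vanishing on it. -/
theorem exists_firstIntegral [FiniteDimensional ℝ E] {X : E → E} {s : Set E}
    (hs : IsOpen s) {p : E} (hp : p ∈ s) (hX : ContDiffOn ℝ ∞ X s) (hXp : X p ≠ 0)
    {α : E →L[ℝ] ℝ} (hα : α (X p) = 0) :
    ∃ (W : Set E) (F : E → ℝ), IsOpen W ∧ p ∈ W ∧ W ⊆ s ∧ ContDiffOn ℝ ∞ F W ∧
      (∀ u ∈ W, fderiv ℝ F u (X u) = 0) ∧ fderiv ℝ F p = α := by
  have : CompleteSpace E := FiniteDimensional.complete ℝ E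
  obtain ⟨Y, hY, hYX⟩ := exists_contDiff_eventuallyEq hs hp hX
  have hYp : Y p = X p := hYX.eq_of_nhds
  obtain ⟨e, h0, he0, het, hsymm, hder, hline⟩ :=
    exists_flowBox hY (hYp ▸ hXp) (Filter.inter_mem (hs.mem_nhds hp) hYX)
  have hpt : p ∈ e.target := he0 ▸ e.map_source h0
  have hF : ContDiffOn ℝ ∞ (fun u => α (e.symm u)) e.target := α.contDiff.comp_contDiffOn hsymm
  have hFd : ∀ u ∈ e.target, HasFDerivAt (fun u => α (e.symm u))
      (fderiv ℝ (fun u => α (e.symm u)) u) u := fun u hu =>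
    ((hF.contDiffAt (e.open_target.mem_nhds hu)).differentiableAt (by simp)).hasFDerivAt
  have hinv : ∀ y ∈ e.source, (fun z => α (e.symm (e z))) =ᶠ[𝓝 y] α := fun y hy => by
    filter_upwards [e.open_source.mem_nhds hy] with z hz
    rw [e.left_inv hz]
  refine ⟨e.target, fun u => α (e.symm u), e.open_target, hpt, fun u hu => (het hu).1, hF, ?_, ?_⟩
  · intro u hu
    have hy := e.map_target hu
    have h1 := (hFd u hu).comp_hasDerivAt_of_eq (0 : ℝ) (hline _ hy)
      (by rw [zero_smul, add_zero, e.right_inv hu])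
    rw [e.right_inv hu, show Y u = X u from (het hu).2] at h1
    have h2 : HasDerivAt (fun τ : ℝ => e.symm u + τ • Y p) (Y p) 0 := by
      simpa using ((hasDerivAt_id (0 : ℝ)).smul_const (Y p)).const_add (e.symm u)
    have h3 := (α.hasFDerivAt (x := e.symm u)).comp_hasDerivAt_of_eq (0 : ℝ) h2 (by simp)
    rw [hYp, hα, ← hYp] at h3
    refine h1.unique (h3.congr_of_eventuallyEq ?_)
    have h4 := hinv _ hy
    have h5 : Filter.Tendsto (fun τ : ℝ => e.symm u + τ • Y p) (𝓝 0) (𝓝 (e.symm u)) := by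
      simpa using h2.continuousAt.tendsto
    exact h5.eventually h4
  · have h1 := HasFDerivAt.comp (g := fun u => α (e.symm u)) 0 (by rw [he0]; exact hFd p hpt) hder
    have h2 := h1.unique (α.hasFDerivAt.congr_of_eventuallyEq (hinv 0 h0))
    exact h2

end FirstIntegral

section Chart

variable {E : Type*} [NormedAddCommGroup E] [NormedSpace ℝ E] [FiniteDimensional ℝ E]
  {H : Type*} [TopologicalSpace H] (I : ModelWithCorners ℝ E H) [I.Boundaryless]
  {M : Type*} [TopologicalSpace M] [ChartedSpace H M] [IsManifold I ∞ M]

/-- The representation of a vector field in the preferred chart at `x`. -/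
def chartField (x : M) (V : Π y : M, TangentSpace I y) : E → E :=
  mpullbackWithin 𝓘(ℝ, E) I (extChartAt I x).symm V (range I)

/-- The representation of a function in the preferred chart at `x`. -/
def chartFun (x : M) (f : M → ℝ) : E → ℝ := f ∘ (extChartAt I x).symm

variable {I} {x : M} {V W : Π y : M, TangentSpace I y} {f : M → ℝ}

theorem contMDiffAt_extChartAt_symm {u : E} (hu : u ∈ (extChartAt I x).target) :
    ContMDiffAt 𝓘(ℝ, E) I ∞ (extChartAt I x).symm u :=
  (contMDiffOn_extChartAt_symm x).contMDiffAt ((isOpen_extChartAt_target x).mem_nhds hu)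

theorem mdifferentiableAt_extChartAt_symm {u : E} (hu : u ∈ (extChartAt I x).target) :
    MDifferentiableAt 𝓘(ℝ, E) I (extChartAt I x).symm u :=
  (contMDiffAt_extChartAt_symm hu).mdifferentiableAt (by simp)

theorem mvfderiv_eq_fderiv (F : E → ℝ) (u v : E) :
    mvfderiv 𝓘(ℝ, E) F u v = fderiv ℝ F u v := by
  rw [← mfderiv_eq_fderiv]
  rfl

theorem eventuallyEq_chartFun_comp (f : M → ℝ) :
    f =ᶠ[𝓝 x] chartFun I x f ∘ extChartAt I x := by
  filter_upwards [extChartAt_source_mem_nhds (I := I) x] with y hy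
  rw [Function.comp_apply, chartFun, Function.comp_apply, (extChartAt I x).left_inv hy]

theorem mfderiv_extChartAt_symm_chartField {u : E} (hu : u ∈ (extChartAt I x).target) :
    mfderiv 𝓘(ℝ, E) I (extChartAt I x).symm u (chartField (E := E) I x V u)
      = V ((extChartAt I x).symm u) := by
  have hinv := isInvertible_mfderivWithin_extChartAt_symm (I := I) hu
  rw [← mfderivWithin_univ, ← I.range_eq_univ]
  exact hinv.self_apply_inverse _

theorem dirDeriv_extChartAt_symm {u : E} (hu : u ∈ (extChartAt I x).target)
    (hf : MDifferentiableAt I 𝓘(ℝ, ℝ) f ((extChartAt I x).symm u)) :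
    dirDeriv I V f ((extChartAt I x).symm u)
      = fderiv ℝ (chartFun I x f) u (chartField I x V u) := by
  have h := mvfderiv_comp_apply u hf (mdifferentiableAt_extChartAt_symm hu)
    (chartField (E := E) I x V u)
  rw [mfderiv_extChartAt_symm_chartField hu] at h
  rw [dirDeriv, ← h, mvfderiv_eq_fderiv]
  rfl

theorem contDiffAt_chartFun {n : ℕ∞} (hf : ContMDiffAt I 𝓘(ℝ, ℝ) n f x) :
    ContDiffAt ℝ n (chartFun I x f) (extChartAt I x x) := by
  refine ContMDiffAt.contDiffAt (ContMDiffAt.comp _ ?_ ((contMDiffAt_extChartAt_symm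
    (mem_extChartAt_target x)).of_le (by exact_mod_cast le_top)))
  rwa [extChartAt_to_inv]

theorem differentiableAt_chartField (hV : MDiffAt (T% V) x) :
    DifferentiableAt ℝ (chartField I x V) (extChartAt I x x) := by
  have : CompleteSpace E := FiniteDimensional.complete ℝ E
  have : IsManifold I 2 M := IsManifold.of_le (n := ∞) (WithTop.coe_le_coe.2 le_top)
  have h : DifferentiableWithinAt ℝ (chartField I x V)
      ((extChartAt I x).symm ⁻¹' univ ∩ range I) (extChartAt I x x) :=
    hV.mdifferentiableWithinAt.differentiableWithinAt_mpullbackWithin_vectorField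
  rwa [preimage_univ, univ_inter, I.range_eq_univ, differentiableWithinAt_univ] at h

theorem eventually_mdifferentiableAt {f : M → ℝ} (hf : ContMDiffAt I 𝓘(ℝ, ℝ) 2 f x) :
    ∀ᶠ y in 𝓝 x, MDifferentiableAt I 𝓘(ℝ, ℝ) f y :=
  (contMDiffAt_iff_contMDiffAt_nhds (by simp) |>.1 hf).mono fun _ hy =>
    hy.mdifferentiableAt (by simp)

theorem dirDeriv_comp_symm_eventuallyEq (V : Π y : M, TangentSpace I y)
    (hf : ContMDiffAt I 𝓘(ℝ, ℝ) 2 f x) :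
    chartFun I x (dirDeriv I V f) =ᶠ[𝓝 (extChartAt I x x)]
      fun u => fderiv ℝ (chartFun I x f) u (chartField I x V u) := by
  have hsymm := (mdifferentiableAt_extChartAt_symm (mem_extChartAt_target (I := I) x)).continuousAt
  rw [ContinuousAt, extChartAt_to_inv] at hsymm
  filter_upwards [hsymm.eventually (eventually_mdifferentiableAt hf),
    (isOpen_extChartAt_target x).mem_nhds (mem_extChartAt_target (I := I) x)] with u hu1 hu2
  exact dirDeriv_extChartAt_symm hu2 hu1

theorem mdifferentiableAt_of_chartFun
    (hf : DifferentiableAt ℝ (chartFun I x f) (extChartAt I x x)) :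
    MDifferentiableAt I 𝓘(ℝ, ℝ) f x := by
  have h1 : MDifferentiableAt I 𝓘(ℝ, E) (extChartAt I x) x :=
    (contMDiffAt_extChartAt (n := 1)).mdifferentiableAt (by simp)
  have h2 := MDifferentiableAt.comp x hf.mdifferentiableAt h1
  exact h2.congr_of_eventuallyEq (eventuallyEq_chartFun_comp f)

theorem differentiableAt_fderiv_chartFun_apply (hf : ContMDiffAt I 𝓘(ℝ, ℝ) 2 f x)
    (hV : MDiffAt (T% V) x) :
    DifferentiableAt ℝ (fun u => fderiv ℝ (chartFun I x f) u (chartField I x V u))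
      (extChartAt I x x) := by
  have h := (contDiffAt_chartFun (n := 2) hf).fderiv_right (m := 1) (by norm_num)
  exact (h.differentiableAt (by simp)).clm_apply (differentiableAt_chartField hV)

/-- The derivative of a `C²` function along a differentiable vector field is differentiable. -/
theorem mdifferentiableAt_dirDeriv (hf : ContMDiffAt I 𝓘(ℝ, ℝ) 2 f x) (hV : MDiffAt (T% V) x) :
    MDifferentiableAt I 𝓘(ℝ, ℝ) (dirDeriv I V f) x :=
  mdifferentiableAt_of_chartFun
    ((differentiableAt_fderiv_chartFun_apply hf hV).congr_of_eventuallyEq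
      (dirDeriv_comp_symm_eventuallyEq V hf))

theorem dirDeriv_dirDeriv (hf : ContMDiffAt I 𝓘(ℝ, ℝ) 2 f x)
    (hW : MDiffAt (T% W) x) :
    dirDeriv I V (dirDeriv I W f) x =
      fderiv ℝ (fderiv ℝ (chartFun I x f)) (extChartAt I x x) (chartField I x V (extChartAt I x x))
        (chartField I x W (extChartAt I x x))
      + fderiv ℝ (chartFun I x f) (extChartAt I x x)
        (fderiv ℝ (chartField I x W) (extChartAt I x x) (chartField I x V (extChartAt I x x))) := by
  have h := dirDeriv_extChartAt_symm (V := V) (f := dirDeriv I W f)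
    (mem_extChartAt_target (I := I) x)
    (by rw [extChartAt_to_inv]; exact mdifferentiableAt_dirDeriv hf hW)
  rw [extChartAt_to_inv] at h
  rw [h, (dirDeriv_comp_symm_eventuallyEq W hf).fderiv_eq]
  have h2 := (contDiffAt_chartFun (n := 2) hf).fderiv_right (m := 1) (by norm_num)
  rw [fderiv_clm_apply (h2.differentiableAt (by simp)) (differentiableAt_chartField hW)]
  simp [add_comm]

/-- The Lie bracket acts on functions as the commutator of derivations. -/
theorem dirDeriv_mlieBracket (hf : ContMDiffAt I 𝓘(ℝ, ℝ) 2 f x)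
    (hV : MDiffAt (T% V) x) (hW : MDiffAt (T% W) x) :
    dirDeriv I (mlieBracket I V W) f x
      = dirDeriv I V (dirDeriv I W f) x - dirDeriv I W (dirDeriv I V f) x := by
  have hchart : ∀ v : TangentSpace I x, mvfderiv I f x v
      = fderiv ℝ (chartFun I x f) (extChartAt I x x)
        (mfderiv I 𝓘(ℝ, E) (extChartAt I x) x v) := by
    intro v
    have h1 : MDifferentiableAt I 𝓘(ℝ, E) (extChartAt I x) x :=
      (contMDiffAt_extChartAt (n := 1)).mdifferentiableAt (by simp)
    have hF : DifferentiableAt ℝ (chartFun I x f) (extChartAt I x x) :=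
      (contDiffAt_chartFun (n := 2) hf).differentiableAt (by simp)
    have h2 := mvfderiv_comp_apply x hF.mdifferentiableAt h1 v
    have h4 : mvfderiv I (chartFun I x f ∘ extChartAt I x) x v = mvfderiv I f x v := by
      simp only [mvfderiv, (eventuallyEq_chartFun_comp (I := I) (x := x) f).mfderiv_eq]
      rfl
    exact (h4.symm.trans h2).trans (mvfderiv_eq_fderiv _ _ _)
  have hsymm : IsSymmSndFDerivAt ℝ (chartFun I x f) (extChartAt I x x) :=
    (contDiffAt_chartFun (n := 2) hf).isSymmSndFDerivAt (by simp)
  have hbracket : mfderiv I 𝓘(ℝ, E) (extChartAt I x) x (mlieBracket I V W x)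
      = lieBracket ℝ (chartField I x V) (chartField I x W) (extChartAt I x x) := by
    rw [← mlieBracketWithin_univ, mlieBracketWithin_apply, preimage_univ, univ_inter]
    refine ((isInvertible_mfderiv_extChartAt (mem_extChartAt_source x)).self_apply_inverse _).trans
      ?_
    change lieBracketWithin ℝ (chartField I x V) (chartField I x W) (range I) _ = _
    rw [I.range_eq_univ, lieBracketWithin_univ]
  rw [dirDeriv_dirDeriv hf hW, dirDeriv_dirDeriv hf hV, dirDeriv, hchart, hbracket, lieBracket,
    map_sub, hsymm.eq]
  ring

end Chart

section Riemannian

variable {E : Type*} [NormedAddCommGroup E] [NormedSpace ℝ E] [FiniteDimensional ℝ E]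
  {H : Type*} [TopologicalSpace H] {I : ModelWithCorners ℝ E H} [I.Boundaryless]
  {M : Type*} [TopologicalSpace M] [ChartedSpace H M] [IsManifold I ∞ M]
  [RiemannianBundle (fun x : M => TangentSpace I x)]
  [IsContMDiffRiemannianBundle I ∞ E (fun x : M => TangentSpace I x)]
  {x : M} {X Y Z : Π y : M, TangentSpace I y} {f : M → ℝ}

/-- The Gram operator of a finite family of vector fields. -/
def gramOperator {ι : Type*} [Fintype ι] [DecidableEq ι] (s : ι → Π y : M, TangentSpace I y)
    (y : M) : (ι → ℝ) →L[ℝ] (ι → ℝ) :=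
  ∑ i, ∑ j, metric I (s i) (s j) y •
    (ContinuousLinearMap.proj (R := ℝ) (φ := fun _ : ι => ℝ) j).smulRight (Pi.single i (1 : ℝ))

theorem gramOperator_apply {ι : Type*} [Fintype ι] [DecidableEq ι]
    (s : ι → Π y : M, TangentSpace I y) (y : M) (c : ι → ℝ) (i : ι) :
    gramOperator s y c i = inner ℝ (s i y) (∑ j, c j • s j y) := by
  simp [gramOperator, metric, Finset.sum_apply, Pi.single_apply, inner_sum, inner_smul_right,
    mul_comm]

theorem gramOperator_injective {ι : Type*} [Fintype ι] [DecidableEq ι]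
    {s : ι → Π y : M, TangentSpace I y} {y : M} (hs : LinearIndependent ℝ fun i => s i y) :
    Function.Injective (gramOperator s y) := by
  refine (injective_iff_map_eq_zero _).2 fun c hc => ?_
  have h : inner ℝ (∑ i, c i • s i y) (∑ j, c j • s j y) = (0 : ℝ) := by
    rw [sum_inner]
    refine Finset.sum_eq_zero fun i _ => ?_
    rw [real_inner_smul_left, ← gramOperator_apply, hc, Pi.zero_apply, mul_zero]
  exact funext (Fintype.linearIndependent_iff.1 hs c (inner_self_eq_zero.1 h))

theorem exists_equiv_gramOperator {ι : Type*} [Fintype ι] [DecidableEq ι]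
    {s : ι → Π y : M, TangentSpace I y} {y : M} (hs : LinearIndependent ℝ fun i => s i y) :
    ∃ A : (ι → ℝ) ≃L[ℝ] (ι → ℝ), (A : (ι → ℝ) →L[ℝ] (ι → ℝ)) = gramOperator s y :=
  ⟨(LinearEquiv.ofInjectiveEndo (gramOperator s y).toLinearMap
    (gramOperator_injective hs)).toContinuousLinearEquiv, by ext1 c; rfl⟩

/-- The gradient of a `C²` function is a differentiable vector field. -/
theorem mdifferentiableAt_gradient (hf : ContMDiffAt I 𝓘(ℝ, ℝ) 2 f x) :
    MDiffAt (T% (gradient I f)) x := by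
  classical
  have : IsManifold I (1 + 1) M := IsManifold.of_le (n := ∞) (WithTop.coe_le_coe.2 le_top)
  let t := trivializationAt E (TangentSpace I : M → Type _) x
  let b := Module.finBasis ℝ E
  let s := t.localFrame b
  have hx : x ∈ t.baseSet := mem_baseSet_trivializationAt' x
  have hs : ∀ i, MDiffAt (T% (s i)) x := fun i =>
    (contMDiffAt_localFrame_of_mem (I := I) 1 t b i hx).mdifferentiableAt (by simp)
  have hli : ∀ y ∈ t.baseSet, LinearIndependent ℝ fun i => s i y := fun y hy =>
    (t.isLocalFrameOn_localFrame_baseSet I 1 b).linearIndependent hy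
  let c : M → Fin (Module.finrank ℝ E) → ℝ := fun y =>
    (gramOperator s y).inverse fun i => dirDeriv I (s i) f y
  have hA : MDifferentiableAt I 𝓘(ℝ, (Fin (Module.finrank ℝ E) → ℝ) →L[ℝ]
      (Fin (Module.finrank ℝ E) → ℝ)) (gramOperator s) x := by
    have h : gramOperator s = ∑ i, ∑ j, fun y => metric I (s i) (s j) y •
        (ContinuousLinearMap.proj (R := ℝ) (φ := fun _ : Fin (Module.finrank ℝ E) => ℝ) j).smulRight
          (Pi.single i (1 : ℝ)) := by
      funext y
      simp only [gramOperator, Finset.sum_apply]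
    rw [h]
    exact .sum fun i _ => .sum fun j _ =>
      (mdifferentiableAt_metric (hs i) (hs j)).smul mdifferentiableAt_const
  have hc : MDifferentiableAt I 𝓘(ℝ, Fin (Module.finrank ℝ E) → ℝ) c x := by
    obtain ⟨A, hAx⟩ := exists_equiv_gramOperator (hli x hx)
    have h1 : DifferentiableAt ℝ ContinuousLinearMap.inverse (gramOperator s x) := by
      rw [← hAx]
      exact (contDiffAt_map_inverse (n := 1) A).differentiableAt (by simp)
    have h2 := h1.mdifferentiableAt.comp x hA
    have h3 : MDifferentiableAt I 𝓘(ℝ, Fin (Module.finrank ℝ E) → ℝ)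
        (fun y i => dirDeriv I (s i) f y) x := by
      have h : (fun y i => dirDeriv I (s i) f y) = ∑ i, fun y =>
          dirDeriv I (s i) f y • (Pi.single i (1 : ℝ) : Fin (Module.finrank ℝ E) → ℝ) := by
        funext y i
        simp [Finset.sum_apply, Pi.single_apply]
      rw [h]
      exact .sum fun i _ => (mdifferentiableAt_dirDeriv hf (hs i)).smul mdifferentiableAt_const
    exact h2.clm_apply h3
  have heq : gradient I f =ᶠ[𝓝 x] fun y => ∑ i, c y i • s i y := by
    filter_upwards [t.open_baseSet.mem_nhds hx] with y hy
    obtain ⟨A, hAy⟩ := exists_equiv_gramOperator (hli y hy)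
    have hsum := (t.isLocalFrameOn_localFrame_baseSet I 1 b).coeff_sum_eq (gradient I f) hy
    set c₀ := fun i => (t.isLocalFrameOn_localFrame_baseSet I 1 b).coeff i y (gradient I f y)
    have h1 : gramOperator s y c₀ = fun i => dirDeriv I (s i) f y := by
      funext i
      rw [gramOperator_apply, dirDeriv, ← inner_gradient, real_inner_comm, hsum]
    have h2 : c y = c₀ := by
      simp only [c]
      rw [← h1, ← hAy, ContinuousLinearMap.inverse_equiv]
      exact A.symm_apply_apply c₀
    rw [h2]
    exact hsum
  have hci : ∀ i, MDifferentiableAt I 𝓘(ℝ, ℝ) (fun y => c y i) x := fun i =>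
    (ContinuousLinearMap.proj (R := ℝ) (φ := fun _ : Fin (Module.finrank ℝ E) => ℝ)
      i).mdifferentiableAt.comp x hc
  have hsec : MDiffAt (T% fun y => ∑ i, c y i • s i y) x :=
    MDifferentiableAt.sum_section fun i _ => (hci i).smul_section (hs i)
  refine hsec.congr_of_eventuallyEq ?_
  filter_upwards [heq] with y hy
  exact congrArg (fun v => (⟨y, v⟩ : TangentBundle I M)) hy

theorem mlieBracket_eq_leviCivita_sub (hX : MDiffAt (T% X) x) (hY : MDiffAt (T% Y) x) :
    mlieBracket I X Y x = leviCivita I Y x (X x) - leviCivita I X x (Y x) :=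
  have : CompleteSpace E := FiniteDimensional.complete ℝ E
  ((CovariantDerivative.torsion_eq_zero_iff (leviCivita I (M := M))).1
    (leviCivita_torsion I) hX hY).symm

/-- The Lie derivative of the metric along `X` is the symmetrization of `∇X`. -/
theorem lieDerivMetric_eq (hX : MDiffAt (T% X) x) (hY : MDiffAt (T% Y) x)
    (hZ : MDiffAt (T% Z) x) :
    lieDerivMetric I X Y Z x
      = inner ℝ (leviCivita I X x (Y x)) (Z x) + inner ℝ (Y x) (leviCivita I X x (Z x)) := by
  have h1 := mlieBracket_eq_leviCivita_sub hX hY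
  have h2 := mlieBracket_eq_leviCivita_sub hX hZ
  rw [lieDerivMetric, leviCivita_metric I hY hX hZ, metric, metric, h1, h2, inner_sub_left,
    inner_sub_right]
  ring

/-- The Lie derivative of the metric evaluated on a gradient. -/
theorem lieDerivMetric_gradient (hf : ContMDiffAt I 𝓘(ℝ, ℝ) 2 f x) (hX : MDiffAt (T% X) x)
    (hY : MDiffAt (T% Y) x) :
    lieDerivMetric I X (gradient I f) Y x
      = dirDeriv I Y (dirDeriv I X f) x - inner ℝ (mlieBracket I X (gradient I f) x) (Y x) := by
  have hgrad : ∀ V : Π y : M, TangentSpace I y, metric I (gradient I f) V = dirDeriv I V f :=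
    fun V => funext fun y => inner_gradient I f y (V y)
  rw [lieDerivMetric, hgrad, hgrad, dirDeriv_mlieBracket hf hX hY, metric]
  ring

end Riemannian

section LinearAlgebra

variable {V : Type*} [NormedAddCommGroup V] [InnerProductSpace ℝ V] [FiniteDimensional ℝ V]

theorem two_mul_trace_eq_sum (A : V →ₗ[ℝ] V) {ι : Type*} [Fintype ι] (b : OrthonormalBasis ι ℝ V) :
    2 * LinearMap.trace ℝ V A
      = ∑ i, (inner ℝ (A (b i)) (b i) + inner ℝ (b i) (A (b i))) := by
  rw [A.trace_eq_sum_inner b, Finset.mul_sum]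
  refine Finset.sum_congr rfl fun i _ => ?_
  rw [real_inner_comm (b i) (A (b i))]
  ring

theorem trace_eq_zero_of_skew {A : V →ₗ[ℝ] V}
    (hA : ∀ v w, inner ℝ (A v) w + inner ℝ v (A w) = (0 : ℝ)) : LinearMap.trace ℝ V A = 0 := by
  have h := two_mul_trace_eq_sum A (stdOrthonormalBasis ℝ V)
  simp only [hA, Finset.sum_const_zero] at h
  linarith

/-- A trace-free operator whose symmetric part kills the orthogonal of a nonzero vector is
skew-symmetric. -/
theorem skew_of_trace_eq_zero {A : V →ₗ[ℝ] V} (htr : LinearMap.trace ℝ V A = 0) {e : V}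
    (he : e ≠ 0)
    (hA : ∀ u w, inner ℝ u e = (0 : ℝ) → inner ℝ (A u) w + inner ℝ u (A w) = (0 : ℝ)) (v w : V) :
    inner ℝ (A v) w + inner ℝ v (A w) = (0 : ℝ) := by
  have hc : inner ℝ e e ≠ (0 : ℝ) := inner_self_ne_zero.2 he
  set c : ℝ := inner ℝ e e with hcdef
  let B : V → V → ℝ := fun v w => inner ℝ (A v) w + inner ℝ v (A w)
  have hsymm : ∀ v w, B v w = B w v := fun v w => by
    simp only [B]
    rw [real_inner_comm w (A v), real_inner_comm v (A w)]
    ring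
  have hproj : ∀ v w, B v w = (inner ℝ v e / c) * B e w := by
    intro v w
    have h0 : inner ℝ (v - (inner ℝ v e / c) • e) e = (0 : ℝ) := by
      rw [inner_sub_left, real_inner_smul_left, ← hcdef, div_mul_cancel₀ _ hc, sub_self]
    have h1 := hA _ w h0
    simp only [map_sub, map_smul, inner_sub_left, real_inner_smul_left] at h1
    simp only [B]
    linarith
  have hB : ∀ v w, B v w = (inner ℝ v e / c) * ((inner ℝ w e / c) * B e e) := fun v w => by
    rw [hproj v w, hsymm e w, hproj w e]
  let b := stdOrthonormalBasis ℝ V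
  have hsum : ∑ i, B (b i) (b i) = 0 := by
    rw [← two_mul_trace_eq_sum A b, htr, mul_zero]
  have hpars : ∑ i, (inner ℝ (b i) e : ℝ) * inner ℝ (b i) e = c := by
    rw [hcdef, ← b.sum_inner_mul_inner e e]
    refine Finset.sum_congr rfl fun i _ => ?_
    rw [real_inner_comm e (b i)]
  have hBe : B e e = 0 := by
    have h1 : ∑ i, B (b i) (b i)
        = (∑ i, (inner ℝ (b i) e : ℝ) * inner ℝ (b i) e) * (B e e / c ^ 2) := by
      rw [Finset.sum_mul]
      refine Finset.sum_congr rfl fun i _ => ?_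
      rw [hB]
      ring
    rw [hsum, hpars] at h1
    field_simp at h1
    linarith
  change B v w = 0
  rw [hB, hBe, mul_zero, mul_zero]

end LinearAlgebra

section Riemannian

variable {E : Type*} [NormedAddCommGroup E] [NormedSpace ℝ E] [FiniteDimensional ℝ E]
  {H : Type*} [TopologicalSpace H] {I : ModelWithCorners ℝ E H} [I.Boundaryless]
  {M : Type*} [TopologicalSpace M] [ChartedSpace H M] [IsManifold I ∞ M]

theorem contDiffOn_chartField {X : Π y : M, TangentSpace I y} (hX : ContMDiff I I.tangent ∞ (T% X))
    (x : M) : ContDiffOn ℝ ∞ (chartField I x X) (extChartAt I x).target := by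
  intro u hu
  have : CompleteSpace E := FiniteDimensional.complete ℝ E
  have hinv : (mfderiv 𝓘(ℝ, E) I (extChartAt I x).symm u).IsInvertible := by
    have h := isInvertible_mfderivWithin_extChartAt_symm (I := I) hu
    rwa [I.range_eq_univ, mfderivWithin_univ] at h
  have h := ContMDiffAt.mpullback_vectorField_preimage (m := ∞) (n := ∞)
    (hX.contMDiffAt (x := (extChartAt I x).symm u)) (contMDiffAt_extChartAt_symm hu) hinv le_rfl
  have h2 : chartField I x X = mpullback 𝓘(ℝ, E) I (extChartAt I x).symm X := by
    rw [chartField, I.range_eq_univ, mpullbackWithin_univ]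
  rw [h2]
  exact (contMDiffAt_vectorSpace_iff_contDiffAt.1 h).contDiffWithinAt

/-- Near a point where it does not vanish, a smooth vector field on a manifold has first integrals
with arbitrary differential among the linear forms vanishing on it. -/
theorem exists_firstIntegral_of_ne_zero {X : Π y : M, TangentSpace I y}
    (hX : ContMDiff I I.tangent ∞ (T% X)) {x : M} (hXx : X x ≠ 0)
    {α : TangentSpace I x →L[ℝ] ℝ} (hα : α (X x) = 0) :
    ∃ (U : Set M) (f : M → ℝ), IsOpen U ∧ x ∈ U ∧ ContMDiffOn I 𝓘(ℝ, ℝ) ∞ f U ∧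
      (∀ y ∈ U, dirDeriv I X f y = 0) ∧ ∀ v, mvfderiv I f x v = α v := by
  let p := extChartAt I x x
  have hp : p ∈ (extChartAt I x).target := mem_extChartAt_target x
  have hval : ∀ V : Π y : M, TangentSpace I y,
      (mfderiv 𝓘(ℝ, E) I (extChartAt I x).symm p (chartField (E := E) I x V p) : E) = V x :=
    fun V => (mfderiv_extChartAt_symm_chartField hp).trans
      (congrArg (fun y => (show E from V y)) (extChartAt_to_inv x))
  let α' : E →L[ℝ] ℝ :=
    (show E →L[ℝ] ℝ from α) ∘L (show E →L[ℝ] E from mfderiv 𝓘(ℝ, E) I (extChartAt I x).symm p)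
  have hα' : ∀ V : Π y : M, TangentSpace I y, α' (chartField I x V p) = α (V x) :=
    fun V => congrArg (show E →L[ℝ] ℝ from α) (hval V)
  have hXp : chartField I x X p ≠ 0 := by
    intro h
    refine hXx ?_
    rw [← hval X, h]
    exact map_zero _
  obtain ⟨W, F, hW, hpW, hWt, hF, hFX, hFp⟩ := exists_firstIntegral
    (isOpen_extChartAt_target x) hp (contDiffOn_chartField hX x) hXp ((hα' X).trans hα)
  let U : Set M := (extChartAt I x).source ∩ extChartAt I x ⁻¹' W
  let f : M → ℝ := F ∘ extChartAt I x
  have hU : IsOpen U :=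
    (continuousOn_extChartAt x).isOpen_inter_preimage (isOpen_extChartAt_source x) hW
  have hf : ContMDiffOn I 𝓘(ℝ, ℝ) ∞ f U :=
    hF.contMDiffOn.comp ((contMDiffOn_extChartAt (x := x)).mono fun y hy => by
      simpa only [extChartAt_source] using hy.1) fun y hy => hy.2
  have hxU : x ∈ U := ⟨mem_extChartAt_source x, hpW⟩
  have hchart : ∀ u ∈ W, chartFun I x f =ᶠ[𝓝 u] F := fun u hu => by
    filter_upwards [hW.mem_nhds hu] with z hz
    change F (extChartAt I x ((extChartAt I x).symm z)) = F z
    rw [(extChartAt I x).right_inv (hWt hz)]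
  have hdir : ∀ (V : Π y : M, TangentSpace I y), ∀ y ∈ U,
      dirDeriv I V f y = fderiv ℝ F (extChartAt I x y) (chartField I x V (extChartAt I x y)) := by
    intro V y hy
    have hinv : (extChartAt I x).symm (extChartAt I x y) = y := (extChartAt I x).left_inv hy.1
    have h := dirDeriv_extChartAt_symm (V := V) (f := f) (hWt hy.2) (by
      rw [hinv]
      exact (hf.contMDiffAt (hU.mem_nhds hy)).mdifferentiableAt (by simp))
    rw [hinv, (hchart _ hy.2).fderiv_eq] at h
    exact h
  refine ⟨U, f, hU, hxU, hf, fun y hy => ?_, fun v => ?_⟩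
  · rw [hdir X y hy]
    exact hFX _ hy.2
  · have h := hdir (extend E v) x hxU
    rw [hFp, hα', dirDeriv, extend_apply_self] at h
    exact h

variable [RiemannianBundle (fun x : M => TangentSpace I x)]
  [IsContMDiffRiemannianBundle I ∞ E (fun x : M => TangentSpace I x)]
  {X : Π y : M, TangentSpace I y}

theorem IsKilling.leviCivita_skew (hX : ContMDiff I I.tangent ∞ (T% X)) (h : IsKilling I X)
    (x : M) (v w : TangentSpace I x) :
    inner ℝ (leviCivita I X x v) w + inner ℝ v (leviCivita I X x w) = (0 : ℝ) := by
  obtain ⟨s, hs, hv⟩ := exists_contMDiffOn_extend (k := ∞) I E v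
  obtain ⟨t, ht, hw⟩ := exists_contMDiffOn_extend (k := ∞) I E w
  have h1 := h (interior (s ∩ t)) isOpen_interior (extend E v) (extend E w)
    (hv.mono (interior_subset.trans inter_subset_left))
    (hw.mono (interior_subset.trans inter_subset_right)) x
    (mem_interior_iff_mem_nhds.2 (Filter.inter_mem hs ht))
  rwa [lieDerivMetric_eq (hX.mdifferentiable (by simp) x) (mdifferentiableAt_extend I E v)
    (mdifferentiableAt_extend I E w), extend_apply_self, extend_apply_self] at h1

theorem finiteDimensional_tangentSpace (x : M) : FiniteDimensional ℝ (TangentSpace I x) :=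
  inferInstanceAs (FiniteDimensional ℝ E)

theorem dirDeriv_eq_zero_of_eventually (V : Π y : M, TangentSpace I y) {h : M → ℝ} {x : M}
    (hh : ∀ᶠ y in 𝓝 x, h y = 0) : dirDeriv I V h x = 0 := by
  have h1 : h =ᶠ[𝓝 x] fun _ => (0 : ℝ) := hh
  have h2 : mvfderiv I h x (V x) = mvfderiv I (fun _ => (0 : ℝ)) x (V x) := by
    simp only [mvfderiv, h1.mfderiv_eq]
    rfl
  rw [dirDeriv, h2, mvfderiv_const]
  rfl

theorem IsKilling.divergence_eq_zero (hX : ContMDiff I I.tangent ∞ (T% X)) (h : IsKilling I X)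
    (x : M) : divergence I X x = 0 :=
  have := finiteDimensional_tangentSpace (I := I) x
  trace_eq_zero_of_skew (h.leviCivita_skew hX x)

theorem IsKilling.mlieBracket_gradient_eq_zero (hX : ContMDiff I I.tangent ∞ (T% X))
    (h : IsKilling I X) {f : M → ℝ} {x : M} (hf : ContMDiffAt I 𝓘(ℝ, ℝ) 2 f x)
    (hXf : ∀ᶠ y in 𝓝 x, dirDeriv I X f y = 0) : mlieBracket I X (gradient I f) x = 0 := by
  refine ext_inner_right ℝ fun w => ?_
  have hXx : MDiffAt (T% X) x := hX.mdifferentiable (by simp) x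
  have hw := mdifferentiableAt_extend I E w
  have h1 := lieDerivMetric_gradient hf hXx hw
  rw [lieDerivMetric_eq hXx (mdifferentiableAt_gradient hf) hw, h.leviCivita_skew hX,
    dirDeriv_eq_zero_of_eventually _ hXf, extend_apply_self] at h1
  rw [inner_zero_left]
  linarith

/-- The converse at points where the vector field does not vanish. -/
theorem leviCivita_skew_of_ne_zero (hX : ContMDiff I I.tangent ∞ (T% X)) {x : M} (hXx : X x ≠ 0)
    (hdiv : divergence I X x = 0)
    (hgrad : ∀ U : Set M, IsOpen U → ∀ f : M → ℝ, ContMDiffOn I 𝓘(ℝ, ℝ) ∞ f U →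
      (∀ x ∈ U, dirDeriv I X f x = 0) → ∀ x ∈ U, mlieBracket I X (gradient I f) x = 0)
    (v w : TangentSpace I x) :
    inner ℝ (leviCivita I X x v) w + inner ℝ v (leviCivita I X x w) = (0 : ℝ) := by
  have := finiteDimensional_tangentSpace (I := I) x
  refine skew_of_trace_eq_zero (A := (leviCivita I X x).toLinearMap) hdiv hXx ?_ v w
  intro u w hu
  obtain ⟨U, f, hU, hxU, hf, hXf, hfx⟩ := exists_firstIntegral_of_ne_zero hX hXx
    (α := innerSL ℝ u) hu
  have hfx2 : ContMDiffAt I 𝓘(ℝ, ℝ) 2 f x :=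
    (hf.contMDiffAt (hU.mem_nhds hxU)).of_le (WithTop.coe_le_coe.2 le_top)
  have hgu : gradient I f x = u :=
    ext_inner_right ℝ fun w => (inner_gradient I f x w).trans (hfx w)
  have hXd : MDiffAt (T% X) x := hX.mdifferentiable (by simp) x
  have hw := mdifferentiableAt_extend I E w
  have h1 := lieDerivMetric_gradient hfx2 hXd hw
  rw [lieDerivMetric_eq hXd (mdifferentiableAt_gradient hfx2) hw, hgrad U hU f hf hXf x hxU,
    dirDeriv_eq_zero_of_eventually _ (Filter.mem_of_superset (hU.mem_nhds hxU) hXf),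
    inner_zero_left, sub_zero, extend_apply_self, hgu] at h1
  exact h1

theorem continuousAt_lieDerivMetric {Y Z : Π y : M, TangentSpace I y} {x : M}
    (hX : ContMDiffAt I I.tangent ∞ (T% X) x) (hY : ContMDiffAt I I.tangent ∞ (T% Y) x)
    (hZ : ContMDiffAt I I.tangent ∞ (T% Z) x) : ContinuousAt (lieDerivMetric I X Y Z) x := by
  have : CompleteSpace E := FiniteDimensional.complete ℝ E
  have : IsManifold I (minSmoothness ℝ 2) M := by
    rw [minSmoothness_of_isRCLikeNormedField]
    exact IsManifold.of_le (n := ∞) (WithTop.coe_le_coe.2 le_top)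
  have : IsManifold I (((2 : ℕ∞) : ℕ∞ω) + 1) M :=
    IsManifold.of_le (n := ∞) (WithTop.coe_le_coe.2 le_top)
  have hle : ((2 : ℕ∞) : ℕ∞ω) ≤ ∞ := WithTop.coe_le_coe.2 le_top
  have hbr : ∀ {V : Π y : M, TangentSpace I y}, ContMDiffAt I I.tangent ∞ (T% V) x →
      MDiffAt (T% (mlieBracket I X V)) x := fun hV =>
    (ContMDiffAt.mlieBracket_vectorField (m := 1) (n := 2) (hX.of_le hle) (hV.of_le hle)
      (by simp [minSmoothness_of_isRCLikeNormedField]; norm_num)).mdifferentiableAt (by simp)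
  have hYZ' : ContMDiffAt I 𝓘(ℝ, ℝ) ∞ (metric I Y Z) x := ContMDiffAt.inner_bundle hY hZ
  have hYZ : ContMDiffAt I 𝓘(ℝ, ℝ) 2 (metric I Y Z) x := hYZ'.of_le hle
  have h1 := (mdifferentiableAt_dirDeriv hYZ (hX.mdifferentiableAt (by simp))).continuousAt
  have h2 := (mdifferentiableAt_metric (hbr hY) (hZ.mdifferentiableAt (by simp))).continuousAt
  have h3 := (mdifferentiableAt_metric (hY.mdifferentiableAt (by simp)) (hbr hZ)).continuousAt
  exact (h1.sub h2).sub h3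

theorem isKilling_of_ne_zero (hX : ContMDiff I I.tangent ∞ (T% X))
    (h : ∀ (x : M), X x ≠ 0 → ∀ (v w : TangentSpace I x),
      inner ℝ (leviCivita I X x v) w + inner ℝ v (leviCivita I X x w) = (0 : ℝ)) :
    IsKilling I X := by
  intro U hU Y Z hY hZ x hx
  have hne : ∀ y ∈ U, X y ≠ 0 → lieDerivMetric I X Y Z y = 0 := fun y hy hXy => by
    rw [lieDerivMetric_eq (hX.mdifferentiable (by simp) y)
      ((hY.contMDiffAt (hU.mem_nhds hy)).mdifferentiableAt (by simp))
      ((hZ.contMDiffAt (hU.mem_nhds hy)).mdifferentiableAt (by simp)), h y hXy]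
  by_cases hfreq : ∃ᶠ y in 𝓝 x, X y ≠ 0
  · have hcont := continuousAt_lieDerivMetric hX.contMDiffAt
      (hY.contMDiffAt (hU.mem_nhds hx)) (hZ.contMDiffAt (hU.mem_nhds hx))
    have hfreq' : ∃ᶠ y in 𝓝 x, lieDerivMetric I X Y Z y ∈ ({0} : Set ℝ) :=
      (hfreq.and_eventually (hU.mem_nhds hx)).mono fun y hy => hne y hy.2 hy.1
    exact isClosed_singleton.mem_of_frequently_of_tendsto hfreq' hcont
  · have h0 : X =ᶠ[𝓝 x] (0 : Π y : M, TangentSpace I y) := by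
      filter_upwards [Filter.not_frequently.1 hfreq] with y hy
      exact not_not.1 hy
    have hbr : ∀ V : Π y : M, TangentSpace I y, mlieBracket I X V x = 0 := fun V =>
      (h0.mlieBracket_vectorField_eq (Filter.EventuallyEq.refl _ V)).trans
        (congrFun mlieBracket_zero_left x)
    have hXx : X x = 0 := h0.eq_of_nhds
    simp [lieDerivMetric, metric, hbr, dirDeriv, hXx]

end Riemannian

end RiemannianGeometry

end

theorem proposition1p1 {n : ℕ} {M : Type*} [TopologicalSpace M] [T2Space M]
    [SecondCountableTopology M] [ChartedSpace (EuclideanSpace ℝ (Fin n)) M]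
    [IsManifold (𝓡 n) ∞ M]
    [RiemannianBundle (fun x : M => TangentSpace (𝓡 n) x)]
    [IsContMDiffRiemannianBundle (𝓡 n) ∞ (EuclideanSpace ℝ (Fin n))
      (fun x : M => TangentSpace (𝓡 n) x)]
    (X : Π x : M, TangentSpace (𝓡 n) x)
    (hX : ContMDiff (𝓡 n) (𝓡 n).tangent ∞ (fun x => (⟨x, X x⟩ : TangentBundle (𝓡 n) M))) :
    RiemannianGeometry.IsKilling (𝓡 n) X ↔
      (∀ x : M, RiemannianGeometry.divergence (𝓡 n) X x = 0) ∧
      (∀ U : Set M, IsOpen U → ∀ f : M → ℝ, ContMDiffOn (𝓡 n) 𝓘(ℝ, ℝ) ∞ f U →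
        (∀ x ∈ U, RiemannianGeometry.dirDeriv (𝓡 n) X f x = 0) →
        ∀ x ∈ U, VectorField.mlieBracket (𝓡 n) X (RiemannianGeometry.gradient (𝓡 n) f) x = 0) := by

  open RiemannianGeometry in
  refine ⟨fun h => ⟨h.divergence_eq_zero hX, fun U hU f hf hXf x hx => ?_⟩, fun h => ?_⟩
  · exact h.mlieBracket_gradient_eq_zero hX
      ((hf.contMDiffAt (hU.mem_nhds hx)).of_le (WithTop.coe_le_coe.2 le_top))
      (Filter.mem_of_superset (hU.mem_nhds hx) hXf)
  · exact isKilling_of_ne_zero hX fun x hXx =>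
      leviCivita_skew_of_ne_zero hX hXx (h.1 x) h.2
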